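/- Let $G$ be a chordal graph (a finite simple graph without induced cycles of length at least four) with vertex set $V$. Let $S(G)$ be the real vector space of symmetric matrices $A\in\mathbb{R}^{V\times V}$ with $A_{ij}=0$ whenever $i\neq j$ and $\{i,j\}$ is not an edge of $G$, and let $$S^*(G)=\{A\in S(G) : A_C\succeq 0 \text{ for every clique } C \text{ of } G\},$$ where $A_C$ is the principal submatrix of $A$ indexed by $C$. Polynomials on $S(G)$ are the polynomials with real coefficients in the entries $X_{ij}=X_{ji}$ with $i=j$ or $\{i,j\}$ an edge of $G$; let $X$ be the symmetric matrix of these unknowns, with zeros at the remaining positions, and put $$p_G(X)=\prod_{C \text{ maximal clique of } G}\det(X_C).$$ A homogeneous polynomial $p$ on $S(G)$ is hyperbolic along $e\in S(G)$ if $p(e)>0$ and, for every $x \in S(G)$, the polynomial $t\mapsto p(x-te)$ has only real roots; its hyperbolicity cone is $\Lambda_+(p,e)=\{x\in S(G) : \text{all roots of } t\mapsto p(te-x) \text{ are nonnegative}\}$. Then $p_G$ is hyperbolic along the identity matrix $I$ and $\Lambda_+(p_G,I)=S^*(G)$. Moreover, $p_G$ is a minimal polynomial of $S^*(G)$: it is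 a nonzero polynomial of minimal degree among those that vanish on the boundary of $S^*(G)$ in $S(G)$, and every polynomial on $S(G)$ that vanishes on this boundary is a multiple of $p_G$. Hence the degree of $p_G$ is $\sum_C |C|$, the sum running over the maximal cliques $C$ of $G$, and this number is the minimal degree of a polynomial $q$ that is hyperbolic along some $e\in S(G)$ and satisfies $\Lambda_+(q,e)=S^*(G)$. -/

import Mathlib

namespace HypCone

section General

variable {ι E : Type*} [AddCommGroup E] [Module ℝ E]

/-- The value at `x` of a polynomial `p` over the real vector space `E`, where `p` is written in the
coordinates of a basis `b` of `E`. -/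
noncomputable def evalAt (b : Module.Basis ι ℝ E) (p : MvPolynomial ι ℝ) (x : E) : ℝ :=
  MvPolynomial.eval (fun i => b.repr x i) p

/-- `p` is hyperbolic along `e`: it is homogeneous, `p(e) > 0`, and for every `x` all complex roots
`z` of the univariate polynomial `t ↦ p(x - t e)` are real. -/
structure IsHyperbolic (b : Module.Basis ι ℝ E) (p : MvPolynomial ι ℝ) (e : E) : Prop where
  homogeneous : ∃ d : ℕ, p.IsHomogeneous d
  pos : 0 < evalAt b p e
  real_rooted : ∀ (x : E) (z : ℂ),
    MvPolynomial.aeval (fun i => ((b.repr x i : ℝ) : ℂ) - z * ((b.repr e i : ℝ) : ℂ)) p = 0 →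
      z.im = 0

/-- The hyperbolicity cone `Λ₊(p, e)`: all roots of `t ↦ p(t e - x)` are nonnegative. -/
def hyperbolicityCone (b : Module.Basis ι ℝ E) (p : MvPolynomial ι ℝ) (e : E) : Set E :=
  {x | ∀ t : ℝ, evalAt b p (t • e - x) = 0 → 0 ≤ t}

/-- `p` vanishes on the (topological) boundary of `K`. -/
def VanishesOnBoundary [TopologicalSpace E] (b : Module.Basis ι ℝ E) (K : Set E)
    (p : MvPolynomial ι ℝ) : Prop :=
  ∀ x ∈ frontier K, evalAt b p x = 0

/-- `p` is a minimal polynomial of `K`: a nonzero polynomial of minimal degree among those that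
vanish on the boundary of `K`. -/
structure IsMinimalPolynomial [TopologicalSpace E] (b : Module.Basis ι ℝ E) (K : Set E)
    (p : MvPolynomial ι ℝ) : Prop where
  ne_zero : p ≠ 0
  vanishes : VanishesOnBoundary b K p
  minimal : ∀ q : MvPolynomial ι ℝ, q ≠ 0 → VanishesOnBoundary b K q →
    p.totalDegree ≤ q.totalDegree

end General

section Graph

variable {V : Type*} [Fintype V] [DecidableEq V]

/-- `G` is chordal: it has no induced cycle of length at least four. -/
def IsChordal (G : SimpleGraph V) : Prop :=
  ∀ k : ℕ, 4 ≤ k → IsEmpty (SimpleGraph.cycleGraph k ↪g G)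

/-- The space `S(G)` of real symmetric matrices whose off-diagonal entries vanish outside the edges
of `G`. -/
def symSpace (G : SimpleGraph V) : Submodule ℝ (Matrix V V ℝ) where
  carrier := {A | A.IsSymm ∧ ∀ i j, i ≠ j → ¬ G.Adj i j → A i j = 0}
  add_mem' {A B} hA hB :=
    ⟨hA.1.add hB.1, fun i j h h' => by simp [hA.2 i j h h', hB.2 i j h h']⟩
  zero_mem' := ⟨Matrix.isSymm_zero, fun _ _ _ _ => rfl⟩
  smul_mem' c A hA := ⟨hA.1.smul c, fun i j h h' => by simp [hA.2 i j h h']⟩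

/-- The identity matrix, as an element of `S(G)`. -/
def idMat (G : SimpleGraph V) : symSpace G :=
  ⟨1, Matrix.isSymm_one, fun _ _ h _ => Matrix.one_apply_ne h⟩

/-- The cone `S*(G)`: those `A ∈ S(G)` with `A_C` positive semidefinite for all cliques `C`. -/
def dualCone (G : SimpleGraph V) : Set (symSpace G) :=
  {A | ∀ C : Finset V, G.IsClique (C : Set V) →
    ((A : Matrix V V ℝ).submatrix (Subtype.val : C → V) (Subtype.val : C → V)).PosSemidef}

/-- Unordered pairs `{i, j}` with `i = j` or `i` adjacent to `j`: the positions of the independent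
entries of a matrix in `S(G)`. -/
abbrev Entry (G : SimpleGraph V) : Type _ := {z : Sym2 V // z.IsDiag ∨ z ∈ G.edgeSet}

noncomputable instance (G : SimpleGraph V) : Fintype (Entry G) := Fintype.ofFinite _

open Classical in
/-- The matrix with entry `c {i, j}` at the positions `(i, j)` of the support, and `0` elsewhere. -/
noncomputable def ofEntries {R : Type*} [Zero R] (G : SimpleGraph V) (c : Entry G → R) :
    Matrix V V R :=
  Matrix.of fun i j =>
    if h : s(i, j).IsDiag ∨ s(i, j) ∈ G.edgeSet then c ⟨s(i, j), h⟩ else 0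

/-- A matrix in `S(G)` is given by its independent entries. -/
noncomputable def entryEquiv (G : SimpleGraph V) : symSpace G ≃ₗ[ℝ] (Entry G → ℝ) where
  toFun A z := Sym2.lift ⟨fun i j => (A : Matrix V V ℝ) i j, fun i j => (A.2.1.apply i j).symm⟩ z.1
  map_add' A B := by
    funext ⟨z, hz⟩
    induction z with | _ i j => simp
  map_smul' c A := by
    funext ⟨z, hz⟩
    induction z with | _ i j => simp
  invFun c := ⟨ofEntries G c, by
    constructor
    · ext i j
      simp only [Matrix.transpose_apply, ofEntries, Matrix.of_apply]
      congr! 3 <;> exact Sym2.eq_swap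
    · intro i j h h'
      simp [ofEntries, h, h']⟩
  left_inv A := by
    ext i j
    by_cases h : s(i, j).IsDiag ∨ s(i, j) ∈ G.edgeSet
    · exact (dif_pos h).trans rfl
    · have h' : i ≠ j ∧ ¬ G.Adj i j := by simpa using h
      exact (dif_neg h).trans (A.2.2 i j h'.1 h'.2).symm
  right_inv c := by
    funext ⟨z, hz⟩
    induction z with | _ i j => exact dif_pos hz

/-- The basis of `S(G)` whose coordinates are the independent matrix entries. -/
noncomputable def entryBasis (G : SimpleGraph V) : Module.Basis (Entry G) ℝ (symSpace G) :=
  Module.Basis.ofEquivFun (entryEquiv G)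

/-- The symmetric matrix of unknowns with support in `G`. -/
noncomputable def genericMatrix (G : SimpleGraph V) :
    Matrix V V (MvPolynomial (Entry G) ℝ) :=
  ofEntries G MvPolynomial.X

open Classical in
/-- The maximal (with respect to inclusion) cliques of `G`. -/
noncomputable def maximalCliques (G : SimpleGraph V) : Finset (Finset V) :=
  {C | Maximal (fun D : Finset V => G.IsClique (D : Set V)) C}

/-- `p_G(X) = ∏_C det(X_C)`, the product over the maximal cliques `C` of `G`. -/
noncomputable def cliquePoly (G : SimpleGraph V) : MvPolynomial (Entry G) ℝ :=
  ∏ C ∈ maximalCliques G,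
    ((genericMatrix G).submatrix (Subtype.val : C → V) (Subtype.val : C → V)).det

end Graph

end HypCone

/-! Each factor $\det X_C$ of $p_G$ becomes a characteristic polynomial along lines in direction
$I$. Symmetric matrices have real eigenvalues, so $p_G$ is hyperbolic, and its cone requires
$A_C\succeq 0$ for all maximal cliques, hence for all cliques. Any hyperbolic polynomial vanishes on
the boundary of its closed cone (`IsHyperbolic.vanishesOnBoundary`), so both minimality claims
reduce to one divisibility: $p_G$ divides every $q$ vanishing on the boundary of $S^*(G)$.

For this, each nonempty $\det X_C$ is prime (`prime_cliqueDet`), and it is affine in a diagonal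
variable $X_{vv}$ with leading coefficient $\det X_{C\setminus v}$. Some boundary point
(`cornerMat`) has $\det X_C=0$ while the determinants of all other cliques are positive. Near it the
whole hypersurface $\det X_C=0$ lies in the boundary, so $q$ vanishes there, and pseudo-division in
$X_{vv}$ gives $\det X_C\mid q$ (`cliqueDet_dvd`). The factors of distinct maximal cliques are
coprime, so their product divides $q$. -/

namespace HypCone

open Matrix

/-! ### Determinants and positivity of principal submatrices -/

section LinearAlgebra

variable {V R : Type*}

/-- The principal submatrix of `M` indexed by `C`. -/
abbrev principal (M : Matrix V V R) (C : Finset V) : Matrix C C R :=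
  M.submatrix (Subtype.val : C → V) (Subtype.val : C → V)

/-- `insert v D` as a disjoint sum. -/
def insertEquiv [DecidableEq V] {D : Finset V} {v : V} (hv : v ∉ D) :
    D ⊕ PUnit.{1} ≃ ↥(insert v D) :=
  ((Finset.subtypeInsertEquivOption hv).trans (Equiv.optionEquivSumPUnit _)).symm

@[simp] lemma insertEquiv_inl [DecidableEq V] {D : Finset V} {v : V} (hv : v ∉ D) (d : D) :
    (insertEquiv hv (Sum.inl d) : V) = d := rfl

@[simp] lemma insertEquiv_inr [DecidableEq V] {D : Finset V} {v : V} (hv : v ∉ D) (u : PUnit) :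
    (insertEquiv hv (Sum.inr u) : V) = v := rfl

lemma principal_insert_submatrix [DecidableEq V] (M : Matrix V V R) {D : Finset V} {v : V}
    (hv : v ∉ D) :
    (principal M (insert v D)).submatrix (insertEquiv hv) (insertEquiv hv) =
      fromBlocks (principal M D) (of fun d _ => M d v) (of fun _ d => M v d)
        (of fun _ _ => M v v) := by
  ext (i | i) (j | j) <;> rfl

variable [DecidableEq V]

/-- Linearity of the determinant in row `v`, split into its diagonal entry and the rest: the
determinant is affine in `M v v`. -/
lemma det_principal_insert [CommRing R] (M : Matrix V V R) {D : Finset V} {v : V} (hv : v ∉ D) :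
    (principal M (insert v D)).det =
      (principal M D).det * M v v + (principal (M - single v v (M v v)) (insert v D)).det := by
  rw [← det_submatrix_equiv_self (insertEquiv hv) (principal M _),
    ← det_submatrix_equiv_self (insertEquiv hv) (principal (M - _) _),
    principal_insert_submatrix, principal_insert_submatrix]
  have hne : ∀ d : D, v ≠ d := fun d h => hv (h ▸ d.2)
  set A := principal M D
  set B : Matrix D PUnit R := of fun d _ => M d v
  set C : Matrix PUnit D R := of fun _ d => M v d
  have hA : principal (M - single v v (M v v)) D = A := by
    ext i j
    simp [A, hne]
  have hB : (of fun (d : D) (_ : PUnit.{1}) => (M - single v v (M v v)) d v) = B := by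
    ext i j
    simp [B, hne]
  have hC : (of fun (_ : PUnit.{1}) (d : D) => (M - single v v (M v v)) v d) = C := by
    ext i j
    simp [C, hne]
  have hz : (of fun (_ _ : PUnit.{1}) => (M - single v v (M v v)) v v) = 0 := by
    ext i j
    simp
  rw [hA, hB, hC, hz]
  have key : A.det * M v v = (fromBlocks A B 0 (of fun _ _ => M v v)).det := by
    rw [det_fromBlocks_zero₂₁]
    simp
  have h1 : fromBlocks A B C (of fun _ _ => M v v) =
      updateRow (fromBlocks A B C (of fun _ _ => M v v)) (Sum.inr PUnit.unit)
        (Sum.elim (0 : D → R) (fun _ => M v v) + Sum.elim (C PUnit.unit) 0) := by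
    ext (i | i) (j | j) <;> simp
  rw [key, h1, det_updateRow_add]
  congr 2 <;> ext (i | i) (j | j) <;> simp [updateRow_apply]

/-- The Schur complement of the block on `D` is a scalar with the same sign as the full determinant.
-/
lemma posSemidef_principal_insert {M : Matrix V V ℝ} (hM : M.IsSymm) {D : Finset V} {v : V}
    (hv : v ∉ D) (hD : (principal M D).PosDef) (hdet : 0 ≤ (principal M (insert v D)).det) :
    (principal M (insert v D)).PosSemidef := by
  rw [← posSemidef_submatrix_equiv (insertEquiv hv), principal_insert_submatrix]
  rw [← det_submatrix_equiv_self (insertEquiv hv) (principal M _),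
    principal_insert_submatrix] at hdet
  have hC : (of fun (_ : PUnit.{1}) (d : D) => M v d) = (of fun (d : D) (_ : PUnit.{1}) => M d v)ᴴ := by
    ext i j
    simp [hM.apply]
  rw [hC] at hdet ⊢
  have : Invertible (principal M D) := (hD.isUnit).invertible
  rw [PosDef.fromBlocks₁₁ _ _ hD]
  rw [det_fromBlocks₁₁, mul_nonneg_iff_of_pos_left hD.det_pos, invOf_eq_nonsing_inv] at hdet
  generalize (_ : Matrix PUnit.{1} PUnit.{1} ℝ) - _ = S at hdet ⊢
  have : S = diagonal fun _ => S.det := by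
    ext i j
    simp
  rw [this]
  exact PosSemidef.diagonal fun _ => hdet

/-- A form of Sylvester's criterion: positive semidefiniteness passes from `D` to `insert v D`, and
a nonzero determinant makes it definite. -/
lemma posDef_principal_of_det_pos {M : Matrix V V ℝ} (hM : M.IsSymm) (T : Finset V)
    (h : ∀ D ⊆ T, 0 < (principal M D).det) : (principal M T).PosDef := by
  induction T using Finset.induction_on with
  | empty => exact ⟨by ext i; exact absurd i.2 (Finset.notMem_empty _), fun x hx => (hx (Subsingleton.elim _ _)).elim⟩
  | insert v D hv ih =>
    have h1 := h _ subset_rfl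
    exact ((posSemidef_principal_insert hM hv (ih fun E hE => h E
      (hE.trans (Finset.subset_insert _ _))) h1.le).posDef_iff_det_ne_zero).2 h1.ne'

lemma im_eq_zero_of_det_sub_smul {n : Type*} [Fintype n] [DecidableEq n] {A : Matrix n n ℝ}
    (hA : A.IsSymm) {z : ℂ} (h : (A.map (fun x => (x : ℂ)) - z • (1 : Matrix n n ℂ)).det = 0) :
    z.im = 0 := by
  have hH : (A.map (fun x => (x : ℂ))).IsHermitian := by
    ext i j
    simp [hA.apply]
  have h2 : (A.map (fun x => (x : ℂ))).charpoly.eval z = 0 := by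
    rw [eval_charpoly, ← neg_sub, det_neg]
    simp only [scalar_apply, ← smul_one_eq_diagonal, h, mul_zero]
  rw [hH.charpoly_eq, Polynomial.eval_prod, Finset.prod_eq_zero_iff] at h2
  obtain ⟨i, -, hi⟩ := h2
  simp only [Polynomial.eval_sub, Polynomial.eval_X, Polynomial.eval_C, sub_eq_zero] at hi
  simp [hi]

lemma posSemidef_iff_forall_det {n : Type*} [Fintype n] [DecidableEq n] {A : Matrix n n ℝ}
    (hA : A.IsSymm) :
    A.PosSemidef ↔ ∀ t : ℝ, (t • (1 : Matrix n n ℝ) - A).det = 0 → 0 ≤ t := by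
  have hH : A.IsHermitian := by
    ext i j
    simp [hA.apply]
  have key (t : ℝ) : (t • (1 : Matrix n n ℝ) - A).det = ∏ i, (t - hH.eigenvalues i) := by
    have := congrArg (Polynomial.eval t) hH.charpoly_eq
    rw [eval_charpoly, Polynomial.eval_prod] at this
    simpa [← smul_one_eq_diagonal] using this
  simp only [key, Finset.prod_eq_zero_iff, hH.posSemidef_iff_eigenvalues_nonneg]
  constructor
  · rintro h t ⟨i, -, hi⟩
    rw [sub_eq_zero.1 hi]
    exact h i
  · exact fun h i => h _ ⟨i, Finset.mem_univ i, sub_self _⟩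

end LinearAlgebra

end HypCone

namespace HypCone

open Matrix

/-! ### Divisibility by a prime that is affine in one variable -/

section Polynomials

open MvPolynomial Topology Filter

lemma det_mem_subalgebra {R A n : Type*} [CommRing R] [CommRing A] [Algebra R A] [Fintype n]
    [DecidableEq n] (S : Subalgebra R A) {M : Matrix n n A} (h : ∀ i j, M i j ∈ S) :
    M.det ∈ S := by
  have : M = (of fun i j => (⟨M i j, h i j⟩ : S)).map S.val := rfl
  rw [this]
  change (S.val.mapMatrix _).det ∈ S
  rw [← AlgHom.map_det]
  exact Subtype.prop _

lemma eval_update_of_mem_supported {σ R : Type*} [CommRing R] [DecidableEq σ] {x : σ}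
    {p : MvPolynomial σ R} (hp : p ∈ supported R {x}ᶜ) (z : σ → R) (a : R) :
    eval (Function.update z x a) p = eval z p := by
  refine eval₂Hom_congr' rfl (fun i hi _ => ?_) rfl
  exact Function.update_of_ne (by simpa using mem_supported.1 hp hi) _ _

/-- Pseudo-division by `g * X x + h` in the variable `x`: powers of `g` clear the denominators, and
the remainder is free of `x`. -/
lemma exists_pow_mul_eq_mul_add {σ R : Type*} [CommRing R] {x : σ} {g h : MvPolynomial σ R}
    (hg : g ∈ supported R {x}ᶜ) (hh : h ∈ supported R {x}ᶜ) (q : MvPolynomial σ R) :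
    ∃ (N : ℕ) (s r : MvPolynomial σ R), r ∈ supported R {x}ᶜ ∧
      g ^ N * q = (g * X x + h) * s + r := by
  nontriviality R
  induction q using MvPolynomial.induction_on with
  | C a => exact ⟨0, 0, C a, Subalgebra.algebraMap_mem _ a, by simp⟩
  | add p q hp hq =>
    obtain ⟨N, s, r, hr, e⟩ := hp
    obtain ⟨N', s', r', hr', e'⟩ := hq
    refine ⟨N + N', g ^ N' * s + g ^ N * s', g ^ N' * r + g ^ N * r',
      add_mem (mul_mem (pow_mem hg _) hr) (mul_mem (pow_mem hg _) hr'), ?_⟩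
    linear_combination g ^ N' * e + g ^ N * e'
  | mul_X p i hp =>
    obtain ⟨N, s, r, hr, e⟩ := hp
    by_cases hi : i = x
    · subst hi
      -- The term `g * X i * r` is rewritten as `(g * X i + h) * r - r * h`.
      refine ⟨N + 1, g * X i * s + r, - (r * h), neg_mem (mul_mem hr hh), ?_⟩
      linear_combination g * X i * e
    · refine ⟨N, s * X i, r * X i, mul_mem hr (X_mem_supported.2 (by simpa using hi)), ?_⟩
      linear_combination X i * e

lemma eq_zero_of_eventually_eval_eq_zero {σ : Type*} [Finite σ] {r : MvPolynomial σ ℝ}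
    {z₀ : σ → ℝ} (h : ∀ᶠ z in 𝓝 z₀, eval z r = 0) : r = 0 := by
  have := Fintype.ofFinite σ
  obtain ⟨ε, hε, hr⟩ := Metric.eventually_nhds_iff_ball.1 h
  refine funext_set (fun i => Metric.ball (z₀ i) ε)
    (fun i => infinite_of_mem_nhds _ (Metric.ball_mem_nhds _ hε)) fun z hz => ?_
  rw [map_zero]
  exact hr z (by rwa [← ball_pi _ hε] at hz)

/-- A prime polynomial that is linear in one variable divides every polynomial that vanishes on
its zero set near a zero at which the leading coefficient does not vanish. -/
lemma dvd_of_eventually_eval_eq_zero {σ : Type*} [Finite σ] {x : σ} {g h q : MvPolynomial σ ℝ}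
    (hg : g ∈ supported ℝ {x}ᶜ) (hh : h ∈ supported ℝ {x}ᶜ) (hp : Prime (g * X x + h))
    {z₀ : σ → ℝ} (hz : eval z₀ (g * X x + h) = 0) (hgz : eval z₀ g ≠ 0)
    (hq : ∀ᶠ z in 𝓝 z₀, eval z (g * X x + h) = 0 → eval z q = 0) : g * X x + h ∣ q := by
  classical
  obtain ⟨N, s, r, hr, e⟩ := exists_pow_mul_eq_mul_add hg hh q
  -- `φ` solves for coordinate `x`, moving a point onto the zero set of `g * X x + h`; it fixes
  -- `z₀`.
  set φ : (σ → ℝ) → σ → ℝ := fun z => Function.update z x (-(eval z h) / eval z g) with hφ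
  have hφ0 : φ z₀ = z₀ := by
    simp only [map_add, map_mul, eval_X] at hz
    rw [hφ]
    simp only [Function.update_eq_self_iff]
    field_simp
    linarith
  have hcont : ContinuousAt φ z₀ := by
    refine continuousAt_id.update x ?_
    exact ((continuous_eval h).neg.continuousAt).div (continuous_eval g).continuousAt hgz
  have h1 : ∀ᶠ z in 𝓝 z₀, eval (φ z) (g * X x + h) = 0 → eval (φ z) q = 0 :=
    hcont.eventually (by rwa [hφ0])
  have h2 : ∀ᶠ z in 𝓝 z₀, eval z g ≠ 0 := (continuous_eval g).continuousAt.eventually_ne hgz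
  -- The remainder does not depend on `x`, so it takes the same value at `z` and `φ z`, and at `φ z`
  -- both other terms vanish.
  have hr0 : r = 0 := by
    refine eq_zero_of_eventually_eval_eq_zero (z₀ := z₀) ?_
    filter_upwards [h1, h2] with z hz1 hz2
    have h3 : eval (φ z) (g * X x + h) = 0 := by
      simp only [map_add, map_mul, eval_X, hφ, eval_update_of_mem_supported hg,
        eval_update_of_mem_supported hh, Function.update_self]
      field_simp
      ring
    have h4 := congrArg (eval (φ z)) e
    rw [map_mul, hz1 h3, map_add, map_mul, h3, hφ, eval_update_of_mem_supported hr] at h4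
    simpa using h4.symm
  rw [hr0, add_zero] at e
  refine (hp.dvd_or_dvd ⟨s, e⟩).resolve_left fun hd => hgz ?_
  obtain ⟨t, ht⟩ := hp.dvd_of_dvd_pow hd
  rw [ht, map_mul, hz, zero_mul]

end Polynomials

/-! ### The clique determinants: primality, coprimality, homogeneity -/

section CliqueDet

open MvPolynomial

variable {V : Type*} [DecidableEq V] {G : SimpleGraph V}

/-- The determinant of the generic matrix in `S(G)` restricted to `C`. -/
noncomputable def cliqueDet (G : SimpleGraph V) (C : Finset V) : MvPolynomial (Entry G) ℝ :=
  (principal (genericMatrix G) C).det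

/-- The position `(v, v)`. -/
def diagEntry (G : SimpleGraph V) (v : V) : Entry G := ⟨s(v, v), Or.inl rfl⟩

lemma ofEntries_map {R S : Type*} [Zero R] [Zero S] (c : Entry G → R) (f : R → S) (hf : f 0 = 0) :
    (ofEntries G c).map f = ofEntries G (f ∘ c) := by
  ext i j
  simp only [ofEntries, map_apply, of_apply]
  split_ifs <;> simp [hf]

lemma ofEntries_entryEquiv (A : symSpace G) : ofEntries G (entryEquiv G A) = A :=
  congrArg Subtype.val ((entryEquiv G).symm_apply_apply A)

lemma map_cliqueDet {S : Type*} [CommRing S] (f : MvPolynomial (Entry G) ℝ →+* S) (C : Finset V) :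
    f (cliqueDet G C) = (principal (ofEntries G (f ∘ X)) C).det := by
  rw [cliqueDet, RingHom.map_det, ← ofEntries_map _ _ (map_zero f)]
  rfl

lemma eval_cliqueDet (A : symSpace G) (C : Finset V) :
    eval (entryEquiv G A) (cliqueDet G C) = (principal (A : Matrix V V ℝ) C).det := by
  rw [map_cliqueDet]
  have : (eval (entryEquiv G A)) ∘ X = entryEquiv G A := by
    ext
    simp
  rw [this, ofEntries_entryEquiv]

lemma genericMatrix_diag (v : V) : genericMatrix G v v = X (diagEntry G v) :=
  dif_pos (Or.inl rfl)

lemma genericMatrix_mem_supported {v i j : V} (h : ¬ (i = v ∧ j = v)) :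
    genericMatrix G i j ∈ supported ℝ {diagEntry G v}ᶜ := by
  simp only [genericMatrix, ofEntries, of_apply]
  split_ifs with hij
  · refine X_mem_supported.2 fun h' => h ?_
    have : s(i, j) = s(v, v) := congrArg Subtype.val h'
    simpa using this
  · exact zero_mem _

/-- The part of the determinant on `insert v D` free of the diagonal entry at `v`. -/
noncomputable def cliqueRest (G : SimpleGraph V) (v : V) (D : Finset V) :
    MvPolynomial (Entry G) ℝ :=
  (principal (genericMatrix G - single v v (genericMatrix G v v)) (insert v D)).det

lemma cliqueDet_insert {v : V} {D : Finset V} (hv : v ∉ D) :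
    cliqueDet G (insert v D) = cliqueDet G D * X (diagEntry G v) + cliqueRest G v D := by
  rw [← genericMatrix_diag]
  exact det_principal_insert _ hv

lemma cliqueDet_mem_supported {v : V} {D : Finset V} (hv : v ∉ D) :
    cliqueDet G D ∈ supported ℝ {diagEntry G v}ᶜ :=
  det_mem_subalgebra _ fun i _ => genericMatrix_mem_supported fun h => hv (h.1 ▸ i.2)

lemma cliqueRest_mem_supported (v : V) (D : Finset V) :
    cliqueRest G v D ∈ supported ℝ {diagEntry G v}ᶜ := by
  refine det_mem_subalgebra _ fun i j => ?_
  by_cases h : (i : V) = v ∧ (j : V) = v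
  · simp [h.1, h.2]
  · have h' : ¬ (v = (i : V) ∧ v = (j : V)) := fun h' => h ⟨h'.1.symm, h'.2.symm⟩
    simpa [single_apply, h'] using genericMatrix_mem_supported h

/-- A diagonal matrix, as an element of `S(G)`. -/
def diagMat (G : SimpleGraph V) (d : V → ℝ) : symSpace G :=
  ⟨diagonal d, isSymm_diagonal d, fun _ _ h _ => diagonal_apply_ne d h⟩

lemma eval_cliqueDet_diagMat (d : V → ℝ) (C : Finset V) :
    eval (entryEquiv G (diagMat G d)) (cliqueDet G C) = ∏ i ∈ C, d i := by
  rw [eval_cliqueDet, diagMat, principal, submatrix_diagonal _ _ Subtype.val_injective,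
    det_diagonal]
  exact Finset.prod_coe_sort C d

lemma cliqueDet_ne_zero (C : Finset V) : cliqueDet G C ≠ 0 := fun h => by
  have := eval_cliqueDet_diagMat (G := G) (fun _ => 1) C
  simp [h] at this

lemma not_cliqueDet_dvd {C D : Finset V} (h : ¬ C ⊆ D) : ¬ cliqueDet G C ∣ cliqueDet G D := by
  rintro ⟨q, hq⟩
  obtain ⟨v, hv, hvD⟩ := Finset.not_subset.1 h
  -- A diagonal zero at `v` kills the determinant on `C` but not the one on `D`.
  have := congrArg (eval (entryEquiv G (diagMat G fun i => if i = v then 0 else 1))) hq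
  rw [map_mul, eval_cliqueDet_diagMat, eval_cliqueDet_diagMat,
    Finset.prod_eq_zero (i := v) hv (by simp), zero_mul, Finset.prod_eq_one] at this
  · exact one_ne_zero this
  · intro i hi
    rw [if_neg]
    rintro rfl
    exact hvD hi

/-- The permutation matrix exchanging two adjacent vertices, as an element of `S(G)`. -/
def swapMat {v w : V} (h : G.Adj v w) : symSpace G := by
  refine ⟨of fun i j => if Equiv.swap v w i = j then 1 else 0, ?_, fun i j hij hG => ?_⟩
  · ext i j
    simp only [transpose_apply, of_apply]
    congr 1
    rw [Equiv.swap_apply_eq_iff, eq_comm (a := j)]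
  · refine if_neg fun he => ?_
    rcases Equiv.swap_apply_eq_iff.1 he with rfl
    by_cases hv : j = v
    · subst hv
      simp at hG
      exact hG h.symm
    by_cases hw : j = w
    · subst hw
      simp at hG
      exact hG h
    exact hij (Equiv.swap_apply_of_ne_of_ne hv hw)

lemma det_swapMat_ne_zero {v w : V} (h : G.Adj v w) {C : Finset V} (hv : v ∈ C) (hw : w ∈ C) :
    (principal (swapMat h : Matrix V V ℝ) C).det ≠ 0 := by
  have : principal (swapMat h : Matrix V V ℝ) C =
      (Equiv.swap (⟨v, hv⟩ : C) ⟨w, hw⟩).permMatrix ℝ := by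
    ext i j
    simp only [swapMat, submatrix_apply, of_apply, Equiv.Perm.permMatrix, PEquiv.toMatrix_apply,
      Equiv.toPEquiv_apply, Option.mem_some_iff]
    congr 1
    rw [Subtype.ext_iff]
    simp only [Equiv.swap_apply_def, Subtype.ext_iff]
    split_ifs <;> rfl
  rw [this, det_permutation]
  simp

lemma det_swapMat_eq_zero {v w : V} (h : G.Adj v w) {C : Finset V} (hv : v ∉ C) (hw : w ∈ C) :
    (principal (swapMat h : Matrix V V ℝ) C).det = 0 := by
  refine det_eq_zero_of_row_eq_zero ⟨w, hw⟩ fun j => if_neg ?_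
  rw [Equiv.swap_apply_right]
  rintro rfl
  exact hv j.2

/-- Induction on the clique: a polynomial affine in the entry at `(v, v)` is irreducible once its
two coefficients are coprime. The leading one is prime by induction, so it suffices that it does not
divide the constant one. -/
lemma prime_cliqueDet {C : Finset V} (hC : G.IsClique (C : Set V)) (hne : C.Nonempty) :
    Prime (cliqueDet G C) := by
  induction C using Finset.induction_on with
  | empty => exact absurd hne (by simp)
  | insert v D hv ih =>
    rw [← irreducible_iff_prime, cliqueDet_insert hv]
    refine irreducible_mul_X_add _ _ _ (cliqueDet_ne_zero D)
      (fun h => mem_supported.1 (cliqueDet_mem_supported hv) h rfl)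
      (fun h => mem_supported.1 (cliqueRest_mem_supported v D) h rfl) ?_
    rcases D.eq_empty_or_nonempty with rfl | ⟨w, hw⟩
    · simpa [cliqueDet] using isRelPrime_one_left
    · have hp := ih (hC.subset (by simp)) ⟨w, hw⟩
      refine hp.irreducible.isRelPrime_iff_not_dvd.2 ?_
      rintro ⟨q, hq⟩
      have hvw : G.Adj v w := hC (by simp) (by simp [hw]) (by rintro rfl; exact hv hw)
      -- At the matrix swapping `v` and `w`, the minor on `D` is zero, so divisibility would force
      -- the minor on `insert v D` to vanish; but that is the determinant of a permutation matrix.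
      refine det_swapMat_ne_zero hvw (C := insert v D) (by simp) (by simp [hw]) ?_
      rw [← eval_cliqueDet, cliqueDet_insert hv, hq, map_add, map_mul, map_mul, eval_cliqueDet,
        det_swapMat_eq_zero hvw hv hw]
      simp

lemma cliquePoly_eq [Fintype V] (G : SimpleGraph V) :
    cliquePoly G = ∏ C ∈ maximalCliques G, cliqueDet G C := rfl

lemma isHomogeneous_cliqueDet (C : Finset V) : (cliqueDet G C).IsHomogeneous C.card := by
  rw [cliqueDet, det_apply]
  refine IsHomogeneous.sum _ _ _ fun σ _ => ?_
  have h : (∏ i, principal (genericMatrix G) C (σ i) i).IsHomogeneous (∑ _i : C, 1) := by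
    refine IsHomogeneous.prod _ _ _ fun i _ => ?_
    simp only [genericMatrix, ofEntries, submatrix_apply, of_apply]
    split_ifs
    · exact isHomogeneous_X _ _
    · exact isHomogeneous_zero _ _ _
  simp only [Finset.sum_const, Finset.card_univ, Fintype.card_coe, smul_eq_mul, mul_one] at h
  rcases Int.units_eq_one_or (Equiv.Perm.sign σ) with hs | hs <;> rw [hs]
  · simpa using h
  · simpa using h.neg

lemma isHomogeneous_cliquePoly [Fintype V] (G : SimpleGraph V) :
    (cliquePoly G).IsHomogeneous (∑ C ∈ maximalCliques G, C.card) :=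
  IsHomogeneous.prod _ _ _ fun C _ => isHomogeneous_cliqueDet C

end CliqueDet

end HypCone

namespace HypCone

open Matrix MvPolynomial Topology Filter

/-! ### Hyperbolic polynomials on the boundary of their cones -/

section General

variable {ι E : Type*} [AddCommGroup E] [Module ℝ E]

lemma evalAt_smul {b : Module.Basis ι ℝ E} {p : MvPolynomial ι ℝ} {d : ℕ}
    (hp : p.IsHomogeneous d) (c : ℝ) (x : E) : evalAt b p (c • x) = c ^ d * evalAt b p x := by
  rw [evalAt, evalAt, eval_eq, eval_eq, Finset.mul_sum]
  refine Finset.sum_congr rfl fun m hm => ?_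
  have hd : ∑ i ∈ m.support, m i = d := by
    by_contra h
    exact mem_support_iff.1 hm (hp.coeff_eq_zero h)
  simp only [map_smul, Finsupp.smul_apply, smul_eq_mul, mul_pow, Finset.prod_mul_distrib]
  rw [Finset.prod_pow_eq_pow_sum, hd]
  ring

variable [TopologicalSpace E] [IsTopologicalAddGroup E] [ContinuousSMul ℝ E] [T2Space E] [Finite ι]

lemma continuous_evalAt (b : Module.Basis ι ℝ E) (p : MvPolynomial ι ℝ) :
    Continuous (evalAt b p) := by
  have := b.finiteDimensional_of_finite
  have := b.equivFun.toLinearMap.continuous_of_finiteDimensional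
  exact (continuous_eval p).comp this

/-- A hyperbolic polynomial vanishes on the boundary of its hyperbolicity cone. -/
lemma IsHyperbolic.vanishesOnBoundary {b : Module.Basis ι ℝ E} {q : MvPolynomial ι ℝ} {e : E}
    (hq : IsHyperbolic b q e) (hc : IsClosed (hyperbolicityCone b q e)) :
    VanishesOnBoundary b (hyperbolicityCone b q e) q := by
  intro x hx
  obtain ⟨d, hd⟩ := hq.homogeneous
  have hxK : x ∈ hyperbolicityCone b q e := hc.frontier_subset hx
  by_contra hx0
  have hne (y : E) (hy : y ∈ hyperbolicityCone b q e) (s : ℝ) (hs : 0 < s) :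
      evalAt b q (s • e + y) ≠ 0 := fun h => by
    have h' := hy (-s) (by
      rw [show (-s) • e - y = (-1 : ℝ) • (s • e + y) by module, evalAt_smul hd, h, mul_zero])
    linarith
  -- If `q` is nonzero at `x`, it has no zero on the segment from `x` to `e`; by compactness this
  -- persists for all `y` near `x`, which puts them in the cone and contradicts `x` being a boundary
  -- point.
  have hseg : ∀ l ∈ Set.Icc (0 : ℝ) 1, evalAt b q (l • e + (1 - l) • x) ≠ 0 := by
    rintro l ⟨hl0, hl1⟩
    rcases hl1.eq_or_lt with rfl | hl1
    · simpa using hq.pos.ne'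
    rcases hl0.eq_or_lt with rfl | hl0
    · simpa using hx0
    have hl : 0 < 1 - l := by linarith
    rw [show l • e + (1 - l) • x = (1 - l) • ((l / (1 - l)) • e + x) by
      rw [smul_add, smul_smul, mul_div_cancel₀ _ hl.ne'], evalAt_smul hd]
    exact mul_ne_zero (pow_ne_zero _ hl.ne') (hne x hxK _ (by positivity))
  have hcont : Continuous fun z : E × ℝ => evalAt b q (z.2 • e + (1 - z.2) • z.1) :=
    (continuous_evalAt b q).comp (by fun_prop)
  have hev : ∀ᶠ y in 𝓝 x, ∀ l ∈ Set.Icc (0 : ℝ) 1, evalAt b q (l • e + (1 - l) • y) ≠ 0 :=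
    isCompact_Icc.eventually_forall_of_forall_eventually fun l hl =>
      hcont.continuousAt.eventually_ne (hseg l hl)
  have hmem : hyperbolicityCone b q e ∈ 𝓝 x := by
    filter_upwards [hev] with y hy t ht
    by_contra! htn
    have hs : 0 < 1 - t := by linarith
    -- A negative root `t` at `y` rescales to a zero on the segment: `y - t • e` divided by `1 - t`
    -- is a convex combination of `y` and `e`.
    refine hy (-t / (1 - t)) ⟨by apply div_nonneg <;> linarith, by rw [div_le_one hs]; linarith⟩ ?_
    have h1 : 1 - -t / (1 - t) = (1 - t)⁻¹ := by
      field_simp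
      ring
    rw [h1, show (-t / (1 - t)) • e + (1 - t)⁻¹ • y = (-(1 - t)⁻¹) • (t • e - y) by
      rw [div_eq_mul_inv]
      module, evalAt_smul hd, ht, mul_zero]
  exact hx.2 (mem_interior_iff_mem_nhds.2 hmem)

end General

/-! ### The cone of the graph and its boundary -/

section Graph

variable {V : Type*} {G : SimpleGraph V}

lemma isSymm_principal (A : symSpace G) (C : Finset V) :
    (principal (A : Matrix V V ℝ) C).IsSymm :=
  A.2.1.submatrix _

lemma mem_maximalCliques [Fintype V] {C : Finset V} :
    C ∈ maximalCliques G ↔ Maximal (fun D : Finset V => G.IsClique (D : Set V)) C := by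
  simp [maximalCliques]

lemma exists_maximalClique_superset [Fintype V] {D : Finset V} (hD : G.IsClique (D : Set V)) :
    ∃ C ∈ maximalCliques G, D ⊆ C := by
  obtain ⟨C, hDC, hC⟩ := Finite.exists_le_maximal
    (p := fun D : Finset V => G.IsClique (D : Set V)) hD
  exact ⟨C, mem_maximalCliques.2 hC, hDC⟩

lemma isClosed_dualCone (G : SimpleGraph V) : IsClosed (dualCone G) := by
  have : dualCone G = ⋂ (C : Finset V) (_ : G.IsClique (C : Set V)) (x : C → ℝ),
      {A : symSpace G | 0 ≤ star x ⬝ᵥ (principal (A : Matrix V V ℝ) C *ᵥ x)} := by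
    ext A
    simp only [dualCone, Set.mem_ofPred_eq, Set.mem_iInter, posSemidef_iff_dotProduct_mulVec]
    refine forall₂_congr fun C _ => and_iff_right ?_
    rw [IsHermitian, conjTranspose_eq_transpose_of_trivial]
    exact isSymm_principal A C
  rw [this]
  refine isClosed_iInter fun C => isClosed_iInter fun _ => isClosed_iInter fun x => ?_
  have h : Continuous fun A : symSpace G => principal (A : Matrix V V ℝ) C :=
    continuous_subtype_val.matrix_submatrix _ _
  exact isClosed_le continuous_const (continuous_const.dotProduct (h.matrix_mulVec continuous_const))

variable [DecidableEq V]

lemma principal_one (C : Finset V) : principal (1 : Matrix V V ℝ) C = 1 :=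
  submatrix_one _ Subtype.val_injective

/-- Lowering the entry at `(v, v)` by `t > 0` changes the determinant on `insert v D` from zero to
`-t` times the positive minor on `D`, which leaves the cone. -/
lemma mem_frontier_dualCone {A : symSpace G} (hA : A ∈ dualCone G) {v : V} {D : Finset V}
    (hv : v ∉ D) (hC : G.IsClique ((insert v D : Finset V) : Set V))
    (hdet : (principal (A : Matrix V V ℝ) (insert v D)).det = 0)
    (hD : 0 < (principal (A : Matrix V V ℝ) D).det) : A ∈ frontier (dualCone G) := by
  refine ⟨subset_closure hA, fun hint => ?_⟩
  set E := diagMat G (Pi.single v 1)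
  have hcont : Continuous fun t : ℝ => A - t • E := by fun_prop
  have hev : ∀ᶠ t in 𝓝 (0 : ℝ), A - t • E ∈ dualCone G :=
    hcont.continuousAt.eventually (by simpa using mem_interior_iff_mem_nhds.1 hint)
  obtain ⟨t, ht, htpos⟩ := ((hev.filter_mono nhdsWithin_le_nhds).and
    (self_mem_nhdsWithin : Set.Ioi (0 : ℝ) ∈ 𝓝[>] 0)).exists
  have hE : ((A - t • E : symSpace G) : Matrix V V ℝ) = (A : Matrix V V ℝ) - single v v t := by
    change (A : Matrix V V ℝ) - t • diagonal (Pi.single v 1) = _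
    rw [diagonal_single]
    simp
  have hnn := (ht _ hC).det_nonneg
  have hDeq : principal ((A : Matrix V V ℝ) - single v v t) D = principal (A : Matrix V V ℝ) D := by
    ext i j
    have : v ≠ i := fun h => hv (h ▸ i.2)
    simp [this]
  have hrest : (A : Matrix V V ℝ) - single v v t -
      single v v (((A : Matrix V V ℝ) - single v v t) v v) =
      (A : Matrix V V ℝ) - single v v ((A : Matrix V V ℝ) v v) := by
    ext i j
    simp only [Matrix.sub_apply, single_apply]
    split_ifs <;> simp_all
  rw [hE] at hnn
  change 0 ≤ (principal ((A : Matrix V V ℝ) - single v v t) (insert v D)).det at hnn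
  rw [det_principal_insert _ hv] at hdet
  rw [det_principal_insert _ hv, hrest, hDeq] at hnn
  simp only [Matrix.sub_apply, single_apply_same] at hnn
  have : 0 < (principal (A : Matrix V V ℝ) D).det * t := mul_pos hD htpos
  linarith

open Classical in
/-- The identity minus the averaging matrix of a clique. -/
noncomputable def cornerMat {C : Finset V} (hC : G.IsClique (C : Set V)) : symSpace G := by
  refine ⟨1 - of fun i j => if i ∈ C ∧ j ∈ C then (C.card : ℝ)⁻¹ else 0,
    isSymm_one.sub ?_, fun i j hij hG => ?_⟩
  · ext i j
    simp only [transpose_apply, of_apply, and_comm]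
  · have : ¬ (i ∈ C ∧ j ∈ C) := fun h => hG (hC h.1 h.2 hij)
    simp [one_apply_ne hij, this]

/-- A rank-one perturbation of the identity. For nonempty `C` the value is zero when `C ⊆ D` and
positive otherwise. -/
lemma det_principal_cornerMat {C : Finset V} (hC : G.IsClique (C : Set V)) (D : Finset V) :
    (principal (cornerMat hC : Matrix V V ℝ) D).det = 1 - ((D ∩ C).card : ℝ) / C.card := by
  have : principal (cornerMat hC : Matrix V V ℝ) D =
      1 + replicateCol Unit (fun i : D => if (i : V) ∈ C then (-1 : ℝ) else 0) *
        replicateRow Unit (fun i : D => if (i : V) ∈ C then (C.card : ℝ)⁻¹ else 0) := by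
    ext i j
    simp only [cornerMat, submatrix_apply, Matrix.sub_apply, of_apply, Matrix.add_apply, mul_apply,
      replicateCol_apply, replicateRow_apply, one_apply, Subtype.ext_iff]
    by_cases hi : (i : V) ∈ C <;> by_cases hj : (j : V) ∈ C <;> simp [hi, hj, sub_eq_add_neg]
  rw [this, det_one_add_replicateCol_mul_replicateRow, dotProduct]
  have h2 := Finset.sum_coe_sort D fun i : V =>
    (if i ∈ C then (C.card : ℝ)⁻¹ else 0) * if i ∈ C then (-1 : ℝ) else 0
  rw [h2, div_eq_mul_inv]
  simp [Finset.sum_ite_mem, sub_eq_add_neg]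

variable [Fintype V]

lemma evalAt_entryBasis (p : MvPolynomial (Entry G) ℝ) (A : symSpace G) :
    evalAt (entryBasis G) p A = eval (entryEquiv G A) p := rfl

lemma mem_dualCone_iff {A : symSpace G} :
    A ∈ dualCone G ↔ ∀ C ∈ maximalCliques G, (principal (A : Matrix V V ℝ) C).PosSemidef := by
  refine ⟨fun h C hC => h C (mem_maximalCliques.1 hC).1, fun h D hD => ?_⟩
  obtain ⟨C, hC, hDC⟩ := exists_maximalClique_superset hD
  exact (h C hC).submatrix fun d : D => (⟨d, hDC d.2⟩ : C)

lemma eval_cliquePoly (A : symSpace G) :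
    evalAt (entryBasis G) (cliquePoly G) A =
      ∏ C ∈ maximalCliques G, (principal (A : Matrix V V ℝ) C).det := by
  rw [evalAt_entryBasis, cliquePoly_eq, map_prod]
  exact Finset.prod_congr rfl fun C _ => eval_cliqueDet A C

lemma cliquePoly_hyperbolic (G : SimpleGraph V) :
    IsHyperbolic (entryBasis G) (cliquePoly G) (idMat G) where
  homogeneous := ⟨_, isHomogeneous_cliquePoly G⟩
  pos := by
    rw [eval_cliquePoly]
    simp [idMat, principal_one]
  real_rooted x z h := by
    rw [cliquePoly_eq, map_prod, Finset.prod_eq_zero_iff] at h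
    obtain ⟨C, -, hC⟩ := h
    refine im_eq_zero_of_det_sub_smul (isSymm_principal x C) (z := z) ?_
    rw [← hC]
    erw [map_cliqueDet (aeval _ : MvPolynomial (Entry G) ℝ →ₐ[ℝ] ℂ).toRingHom C]
    congr 1
    have h1 : (1 : Matrix C C ℂ) = (principal (idMat G : Matrix V V ℝ) C).map (fun x => (x : ℂ)) := by
      simp [idMat, principal_one]
    rw [h1, ← ofEntries_entryEquiv x, ← ofEntries_entryEquiv (idMat G)]
    ext i j
    simp only [ofEntries, Matrix.sub_apply, Matrix.smul_apply, map_apply, submatrix_apply, of_apply]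
    split_ifs
    · simp
      rfl
    · simp

lemma hyperbolicityCone_cliquePoly (G : SimpleGraph V) :
    hyperbolicityCone (entryBasis G) (cliquePoly G) (idMat G) = dualCone G := by
  ext A
  have h (t : ℝ) (C : Finset V) : principal ((t • idMat G - A : symSpace G) : Matrix V V ℝ) C =
      t • (1 : Matrix C C ℝ) - principal (A : Matrix V V ℝ) C := by
    rw [← principal_one]
    rfl
  simp only [mem_dualCone_iff, posSemidef_iff_forall_det (isSymm_principal A _), hyperbolicityCone,
    Set.mem_ofPred_eq, eval_cliquePoly, Finset.prod_eq_zero_iff, h]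
  exact ⟨fun H C hC t ht => H t ⟨C, hC, ht⟩, fun H t ⟨C, hC, ht⟩ => H C hC t ht⟩

/-- Around the corner matrix of `C`, all other cliques have positive minors, so a zero of `cliqueDet
G C` there is a boundary point of the cone, where `q` vanishes. -/
lemma cliqueDet_dvd {q : MvPolynomial (Entry G) ℝ}
    (hq : VanishesOnBoundary (entryBasis G) (dualCone G) q) {C : Finset V}
    (hC : C ∈ maximalCliques G) : cliqueDet G C ∣ q := by
  have hmax := mem_maximalCliques.1 hC
  rcases C.eq_empty_or_nonempty with rfl | hne
  · simp [cliqueDet]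
  obtain ⟨v, hvC⟩ := hne
  obtain ⟨D, hv, rfl⟩ : ∃ D : Finset V, v ∉ D ∧ insert v D = C :=
    ⟨C.erase v, Finset.notMem_erase v C, Finset.insert_erase hvC⟩
  set C := insert v D with hCdef
  have hcl : G.IsClique (C : Set V) := hmax.1
  -- By maximality, no clique other than `C` contains `C`; the subsets of `T` therefore avoid `C`,
  -- as Sylvester's criterion on `T` needs.
  have hsub {T U : Finset V} (hT : G.IsClique (T : Set V)) (hTC : T ≠ C) (hU : U ⊆ T) :
      G.IsClique (U : Set V) ∧ U ≠ C := by
    refine ⟨hT.subset (by exact_mod_cast hU), ?_⟩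
    rintro rfl
    exact hTC (hmax.eq_of_le hT hU).symm
  have hDC : D ≠ C := fun h => hv (h ▸ hvC)
  have hDcl : G.IsClique (D : Set V) := hcl.subset (by simp [hCdef])
  have hcard : (0 : ℝ) < C.card := by exact_mod_cast Finset.card_pos.2 ⟨v, hvC⟩
  have hpos (T : Finset V) (hT : G.IsClique (T : Set V)) (hTC : T ≠ C) :
      0 < eval (entryEquiv G (cornerMat hcl)) (cliqueDet G T) := by
    rw [eval_cliqueDet, det_principal_cornerMat, sub_pos, div_lt_one hcard, Nat.cast_lt]
    refine Finset.card_lt_card (Finset.inter_subset_right.ssubset_of_ne fun h => hTC ?_)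
    exact (hmax.eq_of_le hT (Finset.inter_eq_right.1 h)).symm
  have hprime := prime_cliqueDet hcl ⟨v, hvC⟩
  have hins : cliqueDet G C = _ := cliqueDet_insert hv
  have hzero : eval (entryEquiv G (cornerMat hcl)) (cliqueDet G C) = 0 := by
    rw [eval_cliqueDet, det_principal_cornerMat, Finset.inter_self, div_self hcard.ne', sub_self]
  rw [hins] at hprime hzero ⊢
  refine dvd_of_eventually_eval_eq_zero (cliqueDet_mem_supported hv) (cliqueRest_mem_supported v D)
    hprime hzero (hpos D hDcl hDC).ne' ?_
  rw [← hins]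
  -- There are finitely many cliques, so one neighbourhood keeps all these minors positive.
  have hev : ∀ᶠ z in 𝓝 (entryEquiv G (cornerMat hcl)), ∀ T : Finset V,
      G.IsClique (T : Set V) → T ≠ C → 0 < eval z (cliqueDet G T) := by
    simp only [eventually_all]
    exact fun T hT hTC => (continuous_eval _).continuousAt.eventually_const_lt (hpos T hT hTC)
  filter_upwards [hev] with z hz hz0
  obtain ⟨A, rfl⟩ := (entryEquiv G).surjective z
  simp only [eval_cliqueDet] at hz hz0
  have hPD {T : Finset V} (hT : G.IsClique (T : Set V)) (hTC : T ≠ C) :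
      (principal (A : Matrix V V ℝ) T).PosDef :=
    posDef_principal_of_det_pos A.2.1 T fun U hU =>
      hz U (hsub hT hTC hU).1 (hsub hT hTC hU).2
  refine hq A (mem_frontier_dualCone (fun T hT => ?_) hv hcl hz0 (hz D hDcl hDC))
  by_cases hTC : T = C
  · rw [hTC]
    exact posSemidef_principal_insert A.2.1 hv (hPD hDcl hDC) hz0.ge
  · exact (hPD hT hTC).posSemidef

lemma cliquePoly_dvd {q : MvPolynomial (Entry G) ℝ}
    (hq : VanishesOnBoundary (entryBasis G) (dualCone G) q) : cliquePoly G ∣ q := by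
  rw [cliquePoly_eq]
  refine Finset.prod_dvd_of_isRelPrime (fun C hC D hD hCD => ?_) fun C hC => cliqueDet_dvd hq hC
  have hC' := mem_maximalCliques.1 hC
  have hD' := mem_maximalCliques.1 hD
  have hsub : ¬ C ⊆ D := fun h => hCD (hC'.eq_of_le hD'.1 h)
  have hne : C.Nonempty := Finset.nonempty_iff_ne_empty.2 fun h => hsub (by simp [h])
  exact (prime_cliqueDet hC'.1 hne).irreducible.isRelPrime_iff_not_dvd.2 (not_cliqueDet_dvd hsub)

lemma cliquePoly_ne_zero (G : SimpleGraph V) : cliquePoly G ≠ 0 :=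
  Finset.prod_ne_zero_iff.2 fun C _ => cliqueDet_ne_zero C

lemma totalDegree_cliquePoly (G : SimpleGraph V) :
    (cliquePoly G).totalDegree = ∑ C ∈ maximalCliques G, C.card :=
  (isHomogeneous_cliquePoly G).totalDegree (cliquePoly_ne_zero G)

lemma totalDegree_cliquePoly_le {q : MvPolynomial (Entry G) ℝ} (hq0 : q ≠ 0)
    (hq : VanishesOnBoundary (entryBasis G) (dualCone G) q) :
    (cliquePoly G).totalDegree ≤ q.totalDegree :=
  totalDegree_le_of_dvd_of_isDomain (cliquePoly_dvd hq) hq0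

lemma vanishesOnBoundary_dualCone {q : MvPolynomial (Entry G) ℝ} {e : symSpace G}
    (hq : IsHyperbolic (entryBasis G) q e)
    (hc : hyperbolicityCone (entryBasis G) q e = dualCone G) :
    VanishesOnBoundary (entryBasis G) (dualCone G) q :=
  hc ▸ hq.vanishesOnBoundary (hc ▸ isClosed_dualCone G)

end Graph

end HypCone

theorem mainTheorem1 {V : Type*} [Fintype V] [DecidableEq V] (G : SimpleGraph V)
    (hG : HypCone.IsChordal G) :
    -- the cone `S*(G)` is the hyperbolicity cone of `p_G` along the identity matrix
    HypCone.IsHyperbolic (HypCone.entryBasis G) (HypCone.cliquePoly G) (HypCone.idMat G) ∧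
    HypCone.hyperbolicityCone (HypCone.entryBasis G) (HypCone.cliquePoly G) (HypCone.idMat G)
      = HypCone.dualCone G ∧
    -- `p_G` is a minimal polynomial of `S*(G)`, and divides all polynomials vanishing on its boundary
    HypCone.IsMinimalPolynomial (HypCone.entryBasis G) (HypCone.dualCone G)
      (HypCone.cliquePoly G) ∧
    (∀ q : MvPolynomial (HypCone.Entry G) ℝ,
      HypCone.VanishesOnBoundary (HypCone.entryBasis G) (HypCone.dualCone G) q →
        HypCone.cliquePoly G ∣ q) ∧
    -- its degree is the sum of the sizes of the maximal cliques, and this is the minimal degree of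
    -- a hyperbolic polynomial that generates `S*(G)` (along any direction)
    (HypCone.cliquePoly G).totalDegree = ∑ C ∈ HypCone.maximalCliques G, C.card ∧
    IsLeast {d : ℕ | ∃ (q : MvPolynomial (HypCone.Entry G) ℝ) (e : HypCone.symSpace G),
        HypCone.IsHyperbolic (HypCone.entryBasis G) q e ∧
        HypCone.hyperbolicityCone (HypCone.entryBasis G) q e = HypCone.dualCone G ∧
        q.totalDegree = d}
      (∑ C ∈ HypCone.maximalCliques G, C.card) := by
  have hyp := HypCone.cliquePoly_hyperbolic G
  have hcone := HypCone.hyperbolicityCone_cliquePoly G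
  refine ⟨hyp, hcone,
    ⟨HypCone.cliquePoly_ne_zero G, HypCone.vanishesOnBoundary_dualCone hyp hcone,
      fun q => HypCone.totalDegree_cliquePoly_le⟩,
    fun q => HypCone.cliquePoly_dvd, HypCone.totalDegree_cliquePoly G,
    ⟨_, _, hyp, hcone, HypCone.totalDegree_cliquePoly G⟩, ?_⟩
  -- Lower bound: a competitor vanishes on the boundary of the cone and is nonzero because it is
  -- positive at `e`.
  rintro d ⟨q, e, hq, hc, rfl⟩
  rw [← HypCone.totalDegree_cliquePoly]
  refine HypCone.totalDegree_cliquePoly_le ?_ (HypCone.vanishesOnBoundary_dualCone hq hc)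
  rintro rfl
  have := hq.pos
  simp [HypCone.evalAt] at this
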